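/- Let $d\ge 1$, $\gamma>0$, and let $\alpha=c_\alpha\mathcal N(m_\alpha,\Sigma_\alpha)$, $\beta=c_\beta\mathcal N(m_\beta,\Sigma_\beta)$ be Gaussian measures on $\mathbb R^d$ with $c_\alpha,c_\beta>0$ and $\Sigma_\alpha,\Sigma_\beta\succ 0$. Call $(\pi_1,\pi_2,\pi)$ *feasible* if $\pi$ is a nonnegative finite Borel measure on $\mathbb R^d\times\mathbb R^d$ with finite second moment whose first and second marginals are $\pi_1$ and $\pi_2$, and $\pi_1,\pi_2$ are absolutely continuous with respect to Lebesgue measure. For a feasible plan put $$J(\pi)=\int\|x_2-x_1\|^2\,d\pi(x_1,x_2)+\gamma\,\mathrm{KL}(\pi_1\|\alpha)+\gamma\,\mathrm{KL}(\pi_2\|\beta)\in[0,\infty],$$ where $\mathrm{KL}(\mu\|\nu)=\int\log\frac{d\mu}{d\nu}\,d\mu-\int d\mu+\int d\nu$ (which is $+\infty$ if $\mu\not\ll\nu$ or if the logarithm is not $\mu$-integrable). **Theorem (Optimality of Gaussian).** (a) Let $(\pi_1,\pi_2,\pi)$ be feasible with common mass $c>0$, let $m_i$ and $\Sigma_i$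 be the mean and the covariance matrix of $\pi_i/c$, and let $\pi_i^{\rm G}=c\,\mathcal N(m_i,\Sigma_i)$, $i=1,2$. Then $\Sigma_1,\Sigma_2\succ0$. Let $$T=\Sigma_1^{-1/2}\bigl(\Sigma_1^{1/2}\Sigma_2\Sigma_1^{1/2}\bigr)^{1/2}\Sigma_1^{-1/2},\qquad t=m_2-Tm_1,$$ and let $\pi^{\rm G}$ be the image of $\pi_1^{\rm G}$ under $x\mapsto(x,Tx+t)$. Then $\pi^{\rm G}$ is $c$ times a (degenerate) Gaussian probability measure on $\mathbb R^d\times\mathbb R^d$, $(\pi_1^{\rm G},\pi_2^{\rm G},\pi^{\rm G})$ is feasible, $\pi^{\rm G}$ has the least transport cost $\int\|x_2-x_1\|^2\,d\pi'$ among all measures $\pi'$ with marginals $\pi_1^{\rm G}$ and $\pi_2^{\rm G}$, and $$J(\pi^{\rm G})\le J(\pi).$$ (b) Consequently the problem reduces, without loss of optimality, to an optimization over masses, means and covariances: the infimum of $J$ over all feasible $(\pi_1,\pi_2,\pi)$ equals the infimum of $J(\pi^{\rm G})$ over all $c>0$, $m_1,m_2\in\mathbb R^d$ and symmetric positive definite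 $\Sigma_1,\Sigma_2$, with $\pi^{\rm G}$ built from $(c,m_1,\Sigma_1,m_2,\Sigma_2)$ as in (a). The infimum of $J$ over the feasible $(\pi_1,\pi_2,\pi)$ for which $\pi$ has a density on $\mathbb R^d\times\mathbb R^d$ has the same value. -/

import Mathlib

open MeasureTheory ProbabilityTheory InformationTheory
open scoped ENNReal NNReal MatrixOrder

noncomputable section

namespace UOT

/-- The space `ℝ^d` with its Euclidean norm. -/
abbrev Space (d : ℕ) : Type := EuclideanSpace ℝ (Fin d)

/-- The covariance matrix of a probability measure on `ℝ^d`. -/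
def covarianceMatrix {d : ℕ} (μ : Measure (Space d)) : Matrix (Fin d) (Fin d) ℝ :=
  Matrix.of fun i j ↦ cov[fun x : Space d ↦ x i, fun x : Space d ↦ x j; μ]

/-- The Gaussian measure `c · N(m, S)` of mass `c`. -/
def gaussianMeasure {d : ℕ} (c : ℝ≥0) (m : Space d) (S : Matrix (Fin d) (Fin d) ℝ) :
    Measure (Space d) :=
  c • multivariateGaussian m S

/-- `(π₁, π₂, π)` is feasible: `π` is a finite measure on `ℝ^d × ℝ^d` with finite second moment,
`π₁` and `π₂` are its two marginals, and these have densities with respect to Lebesgue measure.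
(The plan `π` itself may be singular, as plans carried by the graph of a map always are.) -/
structure IsFeasible {d : ℕ} (π₁ π₂ : Measure (Space d)) (π : Measure (Space d × Space d)) :
    Prop where
  finite : IsFiniteMeasure π
  second_moment : ∫⁻ p, ENNReal.ofReal (‖p.1‖ ^ 2 + ‖p.2‖ ^ 2) ∂π < ∞
  fst_eq : π.fst = π₁
  snd_eq : π.snd = π₂
  fst_ac : π₁ ≪ volume
  snd_ac : π₂ ≪ volume

/-- The quadratic transport cost `∫ ‖x₂ - x₁‖² dπ(x₁, x₂)`. -/
def transportCost {d : ℕ} (π : Measure (Space d × Space d)) : ℝ≥0∞ :=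
  ∫⁻ p, ENNReal.ofReal (‖p.2 - p.1‖ ^ 2) ∂π

/-- The objective `J(π) = ∫ ‖x₂ - x₁‖² dπ + γ KL(π₁ ‖ α) + γ KL(π₂ ‖ β)`, with values in
`[0, ∞]`. -/
def objective {d : ℕ} (γ : ℝ≥0) (α β : Measure (Space d)) (π : Measure (Space d × Space d)) :
    ℝ≥0∞ :=
  transportCost π + γ * klDiv π.fst α + γ * klDiv π.snd β

/-- The matrix `T = S₁^{-1/2} (S₁^{1/2} S₂ S₁^{1/2})^{1/2} S₁^{-1/2}`. -/
def optimalMatrix {d : ℕ} (S₁ S₂ : Matrix (Fin d) (Fin d) ℝ) : Matrix (Fin d) (Fin d) ℝ :=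
  (CFC.sqrt S₁)⁻¹ * CFC.sqrt (CFC.sqrt S₁ * S₂ * CFC.sqrt S₁) * (CFC.sqrt S₁)⁻¹

/-- The affine map `x ↦ T x + t` with `t = m₂ - T m₁`. -/
def optimalMap {d : ℕ} (m₁ : Space d) (S₁ : Matrix (Fin d) (Fin d) ℝ) (m₂ : Space d)
    (S₂ : Matrix (Fin d) (Fin d) ℝ) (x : Space d) : Space d :=
  Matrix.toEuclideanCLM (𝕜 := ℝ) (optimalMatrix S₁ S₂) x +
    (m₂ - Matrix.toEuclideanCLM (𝕜 := ℝ) (optimalMatrix S₁ S₂) m₁)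

/-- The plan induced by the affine map: the image of `c · N(m₁, S₁)` under
`x ↦ (x, T x + t)`. -/
def gaussianPlan {d : ℕ} (c : ℝ≥0) (m₁ : Space d) (S₁ : Matrix (Fin d) (Fin d) ℝ)
    (m₂ : Space d) (S₂ : Matrix (Fin d) (Fin d) ℝ) : Measure (Space d × Space d) :=
  (gaussianMeasure c m₁ S₁).map fun x ↦ (x, optimalMap m₁ S₁ m₂ S₂ x)

/-- The optimal value of the unbalanced optimal transport problem. -/
def uotValue {d : ℕ} (γ : ℝ≥0) (α β : Measure (Space d)) : ℝ≥0∞ :=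
  ⨅ (π₁ : Measure (Space d)) (π₂ : Measure (Space d)) (π : Measure (Space d × Space d))
    (_ : IsFeasible π₁ π₂ π), objective γ α β π

/-- The optimal value of the same problem over the feasible plans that have a density on
`ℝ^d × ℝ^d`. -/
def uotValueAC {d : ℕ} (γ : ℝ≥0) (α β : Measure (Space d)) : ℝ≥0∞ :=
  ⨅ (π₁ : Measure (Space d)) (π₂ : Measure (Space d)) (π : Measure (Space d × Space d))
    (_ : IsFeasible π₁ π₂ π) (_ : π ≪ volume), objective γ α β π

/-- The optimal value over masses, means and (positive definite) covariances only. -/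
def gaussianValue {d : ℕ} (γ : ℝ≥0) (α β : Measure (Space d)) : ℝ≥0∞ :=
  ⨅ (c : ℝ≥0) (m₁ : Space d) (S₁ : Matrix (Fin d) (Fin d) ℝ) (m₂ : Space d)
    (S₂ : Matrix (Fin d) (Fin d) ℝ) (_ : 0 < c) (_ : S₁.PosDef) (_ : S₂.PosDef),
    objective γ α β (gaussianPlan c m₁ S₁ m₂ S₂)

end UOT

end

/-! Replacing a plan by the affine Gaussian plan with the same mass, means and covariances lowers
each of the three terms of `J` separately.

For the entropy terms this is the maximum entropy principle. The log-density of a nondegenerate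
Gaussian is a quadratic polynomial, so its integral sees only the mean and covariance
(`integral_norm_sq_affine_congr`). Hence, if `μ` has finite divergence from a Gaussian `ν` and `μ'`
is the Gaussian with the moments of `μ`, then `KL(μ‖ν) - KL(μ'‖ν) = KL(μ‖μ') ≥ 0`
(`klDiv_tilted_le`). Masses are restored by `klDiv_smul_smul_mono`.

For the transport term, `T` is positive definite with `T S₁ T = S₂`. With `R = √T`, the cost `‖y -
x‖²` is a quadratic in `x`, plus a quadratic in `y`, plus `‖R x - R⁻¹ (y - t)‖²` (`norm_sub_sq_eq`).
The first two integrate to the same value for all plans with the given moments; the last is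
nonnegative and vanishes on the graph `y = T x + t`. This is a duality certificate, and it treats
Gaussian and general competitors alike.

For (b), `uotValue ≤ uotValueAC ≤ gaussianValue ≤ uotValue`. The first inequality is inclusion. The
affine plan is carried by a graph, so the second approximates it by couplings of the same marginals
with a density (`rotatedPlan`). The third is (a), together with the zero plan, which is reached as
the limit of Gaussian plans of vanishing mass. -/

namespace UOT

/-! ### Exponential tilting and Gibbs' inequality -/

section Tilted

variable {X Y : Type*} [MeasurableSpace X] [MeasurableSpace Y]

/-- The normalising integral absorbs `k`. This later discards the Jacobian of an affine change of
variables. -/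
lemma smul_tilted {k : ℝ≥0∞} (hk : k ≠ 0) (hk' : k ≠ ∞) (μ : Measure X) (f : X → ℝ) :
    (k • μ).tilted f = μ.tilted f := by
  have hkr : k.toReal ≠ 0 := ENNReal.toReal_ne_zero.2 ⟨hk, hk'⟩
  rw [Measure.tilted, Measure.tilted, withDensity_smul_measure, ← withDensity_smul' _ _ hk']
  congr 1
  ext x
  rw [Pi.smul_apply, integral_smul_measure, smul_eq_mul, smul_eq_mul]
  nth_rw 1 [← ENNReal.ofReal_toReal hk']
  rw [← ENNReal.ofReal_mul ENNReal.toReal_nonneg]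
  congr 1
  field_simp

lemma map_tilted (e : X ≃ᵐ Y) (μ : Measure X) (f : X → ℝ) :
    (μ.tilted f).map e = (μ.map e).tilted (f ∘ e.symm) := by
  ext s hs
  rw [Measure.map_apply e.measurable hs, tilted_apply' _ _ (e.measurable hs),
    tilted_apply' _ _ hs, e.measurableEmbedding.restrict_map,
    e.measurableEmbedding.lintegral_map, e.measurableEmbedding.integral_map]
  simp

variable {b μ μ' : Measure X} [SigmaFinite b] [IsProbabilityMeasure μ] [IsProbabilityMeasure μ']

/-- Gibbs' inequality in the form of a maximum entropy principle: among the probability measures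
that give `f` and `g` the same mean as `μ'`, the measure `μ'` with log-density `g` is the closest
one to the measure with log-density `f`. -/
lemma klDiv_tilted_le {f g : X → ℝ} (hμ : μ ≪ b) (hμ' : μ' = b.tilted g)
    (hf : Integrable (fun x ↦ Real.exp (f x)) b)
    (hfμ : Integrable f μ) (hfμ' : Integrable f μ') (hgμ : Integrable g μ)
    (hgμ' : Integrable g μ') (hf_eq : ∫ x, f x ∂μ' = ∫ x, f x ∂μ)
    (hg_eq : ∫ x, g x ∂μ' = ∫ x, g x ∂μ) :
    klDiv μ' (b.tilted f) ≤ klDiv μ (b.tilted f) := by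
  by_cases htop : klDiv μ (b.tilted f) = ∞
  · simp [htop]
  have hb : NeZero b :=
    ⟨by rintro rfl; exact NeZero.ne μ (Measure.absolutelyContinuous_zero_iff.1 hμ)⟩
  have hν := isProbabilityMeasure_tilted hf
  obtain ⟨hμν, hint⟩ := klDiv_ne_top_iff.1 htop
  -- Without integrability `tilted` takes the default value `0`, which is not a probability measure.
  have hg : Integrable (fun x ↦ Real.exp (g x)) b := by
    by_contra h
    exact NeZero.ne μ' (by rw [hμ', tilted_of_not_integrable h])
  have hμ'b : μ' ≪ b := hμ' ▸ tilted_absolutelyContinuous b g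
  have hμμ' : μ ≪ μ' := hμ.trans (hμ' ▸ absolutelyContinuous_tilted hg)
  have hμ'ν : μ' ≪ b.tilted f := hμ'b.trans (absolutelyContinuous_tilted hf)
  have hllrb : Integrable (llr μ b) μ := by
    have h1 := (integrable_congr (llr_tilted_right hμ hf)).1 hint
    refine (h1.sub (hfμ.neg.add (integrable_const (Real.log (∫ z, Real.exp (f z) ∂b))))).congr ?_
    filter_upwards with x
    simp
  have h1 := integral_llr_tilted_right hμ hfμ hf hllrb
  have h2 := integral_llr_tilted_right hμ hgμ hg hllrb
  have hself : llr μ' b =ᵐ[μ'] fun x ↦ g x - Real.log (∫ z, Real.exp (g z) ∂b) := by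
    have := log_rnDeriv_tilted_left_self hg
    rw [← hμ'] at this
    exact hμ'b.ae_le this
  have hllrb' : Integrable (llr μ' b) μ' :=
    (integrable_congr hself).2 (hgμ'.sub (integrable_const _))
  have h3 := integral_llr_tilted_right hμ'b hfμ' hf hllrb'
  rw [integral_congr_ae hself, integral_sub hgμ' (integrable_const _)] at h3
  -- Gibbs' inequality for `μ` against `μ'`. By `h1`, `h2`, `h3` and the equal means, the difference
  -- of the two divergences is exactly this quantity.
  have h4 := integral_llr_add_sub_measure_univ_nonneg hμμ'
    (hμ' ▸ integrable_llr_tilted_right hμ hgμ hllrb hg)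
  rw [← hμ'] at h2
  simp only [probReal_univ, integral_const, smul_eq_mul, one_mul] at h1 h2 h3 h4
  rw [klDiv_of_ac_of_integrable hμ'ν (integrable_llr_tilted_right hμ'b hfμ' hllrb' hf),
    klDiv_of_ac_of_integrable hμν hint]
  apply ENNReal.ofReal_le_ofReal
  simp only [probReal_univ]
  linarith

end Tilted

/-- For probability measures, rescaling both arguments acts on the divergence by an increasing
affine map that depends only on `c` and `a`. -/
lemma klDiv_smul_smul_mono {X : Type*} [MeasurableSpace X] {μ μ' ν : Measure X}
    [IsProbabilityMeasure μ] [IsProbabilityMeasure μ'] [IsProbabilityMeasure ν] {c a : ℝ≥0}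
    (hc : c ≠ 0) (ha : a ≠ 0) (h : klDiv μ' ν ≤ klDiv μ ν) :
    klDiv (c • μ') (a • ν) ≤ klDiv (c • μ) (a • ν) := by
  have key (ρ : Measure X) : klDiv (c • ρ) (a • ν) = klDiv (c • ρ) (c • ((c⁻¹ * a) • ν)) := by
    rw [smul_smul, mul_inv_cancel_left₀ hc]
  have hk : c⁻¹ * a ≠ 0 := mul_ne_zero (inv_ne_zero hc) ha
  generalize c⁻¹ * a = k at key hk
  rw [key, key, klDiv_smul_same, klDiv_smul_same]
  gcongr 1
  have hk' : (k : ℝ≥0∞) ≠ 0 := by simpa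
  have ac_iff (ρ : Measure X) : ρ ≪ ν → ρ ≪ k • ν := fun h ↦ h.smul_right hk'
  -- Rescaling the reference measure shifts the log-likelihood ratio by the constant `log k`, so
  -- finiteness is unaffected; the comparison of real values below needs it.
  have ne_top (ρ : Measure X) [IsProbabilityMeasure ρ] :
      klDiv ρ (k • ν) ≠ ∞ ↔ klDiv ρ ν ≠ ∞ := by
    have hinv : ν = k⁻¹ • (k • ν) := by rw [smul_smul, inv_mul_cancel₀ hk, one_smul]
    rw [klDiv_ne_top_iff, klDiv_ne_top_iff]
    have hac : ρ ≪ k • ν ↔ ρ ≪ ν := by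
      refine ⟨fun h ↦ ?_, ac_iff ρ⟩
      rw [hinv]
      exact h.smul_right (c := ((k⁻¹ : ℝ≥0) : ℝ≥0∞)) (by simpa)
    rw [hac]
    refine and_congr_right fun hρ ↦ ?_
    rw [integrable_congr (llr_smul_nnreal_right hρ k (by simpa))]
    refine ⟨fun h ↦ ?_, fun h ↦ h.sub (integrable_const _)⟩
    refine (h.add (integrable_const (Real.log k))).congr (ae_of_all _ fun x ↦ ?_)
    simp
  by_cases htop : klDiv μ (k • ν) = ∞
  · simp [htop]
  have h1 := (ne_top μ).1 htop
  have h2 := ne_top_of_le_ne_top h1 h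
  have h2' := (ne_top μ').2 h2
  rw [← ENNReal.toReal_le_toReal h2' htop]
  obtain ⟨a1, i1⟩ := klDiv_ne_top_iff.1 h1
  obtain ⟨a2, i2⟩ := klDiv_ne_top_iff.1 h2
  rw [toReal_klDiv_smul_right a1 i1 hk, toReal_klDiv_smul_right a2 i2 hk]
  have := (ENNReal.toReal_le_toReal h2 h1).2 h
  simpa using this

/-! ### Densities of Gaussian measures -/

section StdGaussian

variable {E : Type*} [NormedAddCommGroup E] [InnerProductSpace ℝ E] [FiniteDimensional ℝ E]
  [MeasurableSpace E] [BorelSpace E]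

/-- The two characteristic functions agree, by the complex Gaussian integral with linear term `i⟨t,
x⟩`. -/
lemma stdGaussian_eq_tilted :
    stdGaussian E = (volume : Measure E).tilted fun x ↦ -‖x‖ ^ 2 / 2 := by
  have hfun : (fun x : E ↦ Real.exp (-‖x‖ ^ 2 / 2)) =
      fun x : E ↦ Real.exp (-(1 / 2) * ‖x‖ ^ 2) := by
    ext x; congr 1; ring
  have hZ := GaussianFourier.integral_rexp_neg_mul_sq_norm (V := E) (b := 1 / 2) (by norm_num)
  have hZpos : (0 : ℝ) < (Real.pi / (1 / 2)) ^ (Module.finrank ℝ E / 2 : ℝ) := by positivity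
  -- A nonintegrable function would have integral `0` by convention, against the positive value
  -- `hZ`.
  have hint : Integrable (fun x : E ↦ Real.exp (-‖x‖ ^ 2 / 2)) := by
    by_contra h
    rw [hfun] at h
    rw [integral_undef h] at hZ
    exact hZpos.ne hZ
  have := isProbabilityMeasure_tilted hint
  refine Measure.ext_of_charFun ?_
  ext t
  rw [charFun_stdGaussian, charFun_apply, integral_tilted]
  have hC := GaussianFourier.integral_cexp_neg_mul_sq_norm_add (V := E) (b := 1 / 2) (by norm_num)
    Complex.I t
  have hC0 := GaussianFourier.integral_cexp_neg_mul_sq_norm (V := E) (b := 1 / 2) (by norm_num)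
  have hZC : ((∫ x : E, Real.exp (-‖x‖ ^ 2 / 2) : ℝ) : ℂ)
      = ((Real.pi : ℂ) / (1 / 2)) ^ (Module.finrank ℝ E / 2 : ℂ) := by
    rw [← hC0, ← integral_complex_ofReal]
    congr 1 with x
    push_cast
    congr 1
    ring
  have hZ0 : ((∫ x : E, Real.exp (-‖x‖ ^ 2 / 2) : ℝ) : ℂ) ≠ 0 := by
    rw [hfun, hZ]
    exact_mod_cast hZpos.ne'
  rw [← hZC] at hC
  have : ∀ x : E, (Real.exp (-‖x‖ ^ 2 / 2) / ∫ x : E, Real.exp (-‖x‖ ^ 2 / 2)) •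
      Complex.exp (inner ℝ x t * Complex.I) =
      ((∫ x : E, Real.exp (-‖x‖ ^ 2 / 2) : ℝ) : ℂ)⁻¹ *
        Complex.exp (-(1 / 2) * ‖x‖ ^ 2 + Complex.I * inner ℝ t x) := by
    intro x
    rw [Complex.real_smul, Complex.ofReal_div, div_eq_inv_mul, mul_assoc, Complex.ofReal_exp,
      ← Complex.exp_add, real_inner_comm]
    congr 2
    push_cast
    ring
  simp_rw [this]
  rw [integral_const_mul, hC, inv_mul_cancel_left₀ hZ0]
  congr 1
  rw [Complex.I_sq]
  ring

lemma stdGaussian_absolutelyContinuous : stdGaussian E ≪ volume :=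
  stdGaussian_eq_tilted (E := E) ▸ tilted_absolutelyContinuous _ _

/-- The image of the standard Gaussian measure under an affine bijection has the exponential of a
quadratic polynomial as density. -/
lemma map_stdGaussian_eq_tilted (L : E ≃L[ℝ] E) (m : E) :
    (stdGaussian E).map (fun x ↦ m + L x) =
      (volume : Measure E).tilted fun x ↦ -‖(L.symm : E →L[ℝ] E) x + -L.symm m‖ ^ 2 / 2 := by
  let e : E ≃ᵐ E := L.toHomeomorph.toMeasurableEquiv.trans (MeasurableEquiv.addLeft m)
  have he : (fun x ↦ m + L x) = e := rfl
  have hdet : LinearMap.det (L : E →ₗ[ℝ] E) ≠ 0 := L.toLinearEquiv.isUnit_det'.ne_zero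
  have hvol : (volume : Measure E).map e
      = ENNReal.ofReal |(LinearMap.det (L : E →ₗ[ℝ] E))⁻¹| • volume := by
    have : ⇑e = (fun x ↦ m + x) ∘ (L : E →ₗ[ℝ] E) := rfl
    rw [this, ← Measure.map_map (g := fun x ↦ m + x) (f := (L : E →ₗ[ℝ] E))
      (measurable_const_add m) L.continuous.measurable,
      Measure.map_linearMap_addHaar_eq_smul_addHaar _ hdet, Measure.map_smul,
      map_add_left_eq_self]
  rw [stdGaussian_eq_tilted, he, map_tilted, hvol, smul_tilted (by simpa using hdet) (by simp)]
  congr 1 with x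
  have : e.symm x = L.symm (-m + x) := rfl
  simp [this, add_comm]

end StdGaussian

/-! ### Means and covariances -/

section Moments

variable {d : ℕ} {μ μ' : Measure (Space d)} [IsProbabilityMeasure μ] [IsProbabilityMeasure μ']

lemma covarianceBilin_basisFun (hμ : MemLp id 2 μ) (i j : Fin d) :
    covarianceBilin μ (EuclideanSpace.basisFun (Fin d) ℝ i) (EuclideanSpace.basisFun (Fin d) ℝ j) =
      covarianceMatrix μ i j := by
  rw [covarianceBilin_apply_eq_cov hμ]
  simp only [covarianceMatrix, EuclideanSpace.basisFun_inner, Matrix.of_apply]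

lemma covarianceBilin_eq_dotProduct (hμ : MemLp id 2 μ) (x y : Space d) :
    covarianceBilin μ x y = dotProduct x ((covarianceMatrix μ).mulVec y) := by
  have hx := ((EuclideanSpace.basisFun (Fin d) ℝ).sum_repr x).symm
  have hy := ((EuclideanSpace.basisFun (Fin d) ℝ).sum_repr y).symm
  nth_rw 1 [hx, hy]
  simp only [map_sum, map_smul, FunLike.coe_sum, Finset.sum_apply, FunLike.coe_smul,
    Pi.smul_apply, covarianceBilin_basisFun hμ, EuclideanSpace.basisFun_repr, smul_eq_mul,
    dotProduct, Matrix.mulVec, Finset.mul_sum]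
  rw [Finset.sum_comm]
  exact Finset.sum_congr rfl fun i _ ↦ Finset.sum_congr rfl fun j _ ↦ by ring

lemma integrable_norm_sq_affine (hμ : MemLp id 2 μ) (L : Space d →L[ℝ] Space d) (v : Space d) :
    Integrable (fun x ↦ ‖L x + v‖ ^ 2) μ :=
  ((L.comp_memLp' hμ).add (memLp_const v)).integrable_norm_pow (by norm_num)

/-- The integral of `‖L x + v‖ ^ 2` depends only on the mean and the covariance of the measure. -/
lemma integral_norm_sq_affine_congr (hμ : MemLp id 2 μ) (hμ' : MemLp id 2 μ')
    (hmean : ∫ x, x ∂μ = ∫ x, x ∂μ') (hcov : covarianceMatrix μ = covarianceMatrix μ')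
    (L : Space d →L[ℝ] Space d) (v : Space d) :
    ∫ x, ‖L x + v‖ ^ 2 ∂μ = ∫ x, ‖L x + v‖ ^ 2 ∂μ' := by
  have coord (x : Space d) (i : Fin d) :
      L x i = inner ℝ (L.adjoint (EuclideanSpace.basisFun (Fin d) ℝ i)) x := by
    rw [ContinuousLinearMap.adjoint_inner_left, EuclideanSpace.basisFun_inner]
  -- Coordinatewise, `E Y² = Var Y + (E Y)²`.
  have expand (ρ : Measure (Space d)) [IsProbabilityMeasure ρ] (hρ : MemLp id 2 ρ) :
      ∫ x, ‖L x + v‖ ^ 2 ∂ρ = ∑ i, (covarianceBilin ρ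
        (L.adjoint (EuclideanSpace.basisFun (Fin d) ℝ i))
        (L.adjoint (EuclideanSpace.basisFun (Fin d) ℝ i)) +
        (L (∫ x, x ∂ρ) i + v i) ^ 2) := by
    have hmem (a : Space d) : MemLp (fun x ↦ inner ℝ a x) 2 ρ := hρ.const_inner a
    simp_rw [EuclideanSpace.real_norm_sq_eq]
    have hY (i : Fin d) : MemLp (fun x ↦ (L x + v) i) 2 ρ := by
      simp_rw [PiLp.add_apply, coord]
      exact (hmem _).add (memLp_const _)
    rw [integral_finsetSum _ fun i _ ↦ (hY i).integrable_sq]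
    refine Finset.sum_congr rfl fun i _ ↦ ?_
    have hvar := variance_eq_sub (hY i)
    have hmean : ∫ x, (L x + v) i ∂ρ = L (∫ x, x ∂ρ) i + v i := by
      simp_rw [PiLp.add_apply, coord]
      rw [integral_add ((hmem _).integrable (by norm_num)) (integrable_const _),
        integral_inner (f := fun x ↦ x) (hρ.integrable (by norm_num))]
      simp
    have hv : Var[fun x ↦ (L x + v) i; ρ] = covarianceBilin ρ
        (L.adjoint (EuclideanSpace.basisFun (Fin d) ℝ i))
        (L.adjoint (EuclideanSpace.basisFun (Fin d) ℝ i)) := by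
      rw [covarianceBilin_self hρ]
      simp_rw [PiLp.add_apply, coord]
      exact variance_add_const (hmem _).aestronglyMeasurable _
    rw [← hv, hvar, hmean]
    simp
  rw [expand μ hμ, expand μ' hμ', hmean]
  simp_rw [covarianceBilin_eq_dotProduct hμ, covarianceBilin_eq_dotProduct hμ', hcov]

lemma volume_hyperplane_eq_zero {a : Space d} (ha : a ≠ 0) (r : ℝ) :
    volume {u : Space d | inner ℝ a u = r} = 0 := by
  let s : AffineSubspace ℝ (Space d) :=
    { carrier := {u | inner ℝ a u = r}
      smul_vsub_vadd_mem' := fun t p₁ p₂ p₃ h₁ h₂ h₃ ↦ by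
        simp only [Set.mem_ofPred_eq] at *
        simp [inner_add_right, inner_smul_right, inner_sub_right, h₁, h₂, h₃] }
  refine Measure.addHaar_affineSubspace volume s fun hs ↦ ha ?_
  have hmem (u : Space d) : inner ℝ a u = r := by
    have : u ∈ s := hs ▸ AffineSubspace.mem_top ℝ _ u
    exact this
  have h0 := hmem 0
  rw [inner_zero_right] at h0
  have h1 := hmem a
  rwa [← h0, inner_self_eq_zero] at h1

/-- A probability measure with a density and a finite second moment has a positive definite
covariance matrix. -/
lemma posDef_covarianceMatrix (hμ : MemLp id 2 μ) (hac : μ ≪ volume) :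
    (covarianceMatrix μ).PosDef := by
  refine Matrix.PosDef.of_dotProduct_mulVec_pos ?_ fun x hx ↦ ?_
  · ext i j
    simp [covarianceMatrix, covariance_comm]
  · have h := covarianceBilin_eq_dotProduct hμ (WithLp.toLp 2 x) (WithLp.toLp 2 x)
    rw [covarianceBilin_self hμ] at h
    have hx' : WithLp.toLp 2 x ≠ 0 := by simpa using hx
    simp only [star_trivial]
    -- A direction of zero variance would confine `μ` to a hyperplane, which is Lebesgue null.
    refine lt_of_le_of_ne (h ▸ variance_nonneg _ _) fun h0 ↦ ?_
    have hmem : MemLp (fun u ↦ inner ℝ (WithLp.toLp 2 x) u) 2 μ := hμ.const_inner _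
    have hv : Var[fun u ↦ inner ℝ (WithLp.toLp 2 x) u; μ] = 0 := h.trans h0.symm
    have hae := ae_eq_integral_of_variance_eq_zero hmem hv
    set r := ∫ u, inner ℝ (WithLp.toLp 2 x) u ∂μ
    have hnull : volume {u : Space d | inner ℝ (WithLp.toLp 2 x) u = r} = 0 :=
      volume_hyperplane_eq_zero hx' r
    have : μ Set.univ = 0 := by
      rw [← measure_union_null_iff.2 ⟨hac hnull, (ae_iff.1 hae)⟩]
      congr 1
      ext u
      simp [em]
    simp at this

end Moments

/-! ### Entropy minimality of Gaussian measures -/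

section Gaussian

variable {d : ℕ} {m : Space d} {S : Matrix (Fin d) (Fin d) ℝ}

lemma memLp_id_multivariateGaussian : MemLp id 2 (multivariateGaussian m S) :=
  IsGaussian.memLp_two_id

lemma covarianceMatrix_multivariateGaussian (hS : S.PosSemidef) :
    covarianceMatrix (multivariateGaussian m S) = S := by
  ext i j
  exact covariance_eval_multivariateGaussian hS i j

lemma posDef_sqrt (hS : S.PosDef) : (CFC.sqrt S).PosDef := by
  have := hS.isStrictlyPositive
  exact Matrix.isStrictlyPositive_iff_posDef.1 (by cfc_tac)

/-- The linear automorphism of `ℝ^d` given by an invertible matrix. -/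
noncomputable def matrixEquiv (A : Matrix (Fin d) (Fin d) ℝ) (hA : IsUnit A) :
    Space d ≃L[ℝ] Space d :=
  ContinuousLinearEquiv.equivOfInverse (Matrix.toEuclideanCLM (𝕜 := ℝ) A)
    (Matrix.toEuclideanCLM (𝕜 := ℝ) A⁻¹)
    (fun x ↦ by
      rw [← mul_apply_eq_comp, ← map_mul,
        Matrix.nonsing_inv_mul _ ((Matrix.isUnit_iff_isUnit_det A).1 hA), map_one]
      rfl)
    (fun x ↦ by
      rw [← mul_apply_eq_comp, ← map_mul,
        Matrix.mul_nonsing_inv _ ((Matrix.isUnit_iff_isUnit_det A).1 hA), map_one]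
      rfl)

lemma matrixEquiv_apply (A : Matrix (Fin d) (Fin d) ℝ) (hA : IsUnit A) (x : Space d) :
    matrixEquiv A hA x = Matrix.toEuclideanCLM (𝕜 := ℝ) A x := rfl

lemma exists_multivariateGaussian_eq_tilted (hS : S.PosDef) :
    ∃ (L : Space d →L[ℝ] Space d) (v : Space d),
      multivariateGaussian m S = volume.tilted fun x ↦ -‖L x + v‖ ^ 2 / 2 :=
  ⟨_, _, map_stdGaussian_eq_tilted (matrixEquiv _ (posDef_sqrt hS).isUnit) m⟩

lemma multivariateGaussian_absolutelyContinuous (hS : S.PosDef) :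
    multivariateGaussian m S ≪ volume := by
  obtain ⟨L, v, h⟩ := exists_multivariateGaussian_eq_tilted (m := m) hS
  exact h ▸ tilted_absolutelyContinuous _ _

/-- Among the probability measures with a given mean and covariance, the Gaussian one minimizes
the relative entropy with respect to a Gaussian measure. -/
lemma klDiv_multivariateGaussian_le {μ : Measure (Space d)} [IsProbabilityMeasure μ]
    (hμ : MemLp id 2 μ) (hac : μ ≪ volume) {mα : Space d} {Sα : Matrix (Fin d) (Fin d) ℝ}
    (hSα : Sα.PosDef) :
    klDiv (multivariateGaussian (∫ x, x ∂μ) (covarianceMatrix μ)) (multivariateGaussian mα Sα) ≤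
      klDiv μ (multivariateGaussian mα Sα) := by
  have hS := posDef_covarianceMatrix hμ hac
  obtain ⟨L, v, hν⟩ := exists_multivariateGaussian_eq_tilted (m := mα) hSα
  obtain ⟨L', v', hμ'⟩ := exists_multivariateGaussian_eq_tilted (m := ∫ x, x ∂μ) hS
  have hint (L : Space d →L[ℝ] Space d) (v : Space d) {ρ : Measure (Space d)}
      [IsProbabilityMeasure ρ] (hρ : MemLp id 2 ρ) :
      Integrable (fun x ↦ -‖L x + v‖ ^ 2 / 2) ρ :=
    ((integrable_norm_sq_affine hρ L v).neg).div_const 2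
  have heq (L : Space d →L[ℝ] Space d) (v : Space d) :
      ∫ x, -‖L x + v‖ ^ 2 / 2 ∂(multivariateGaussian (∫ x, x ∂μ) (covarianceMatrix μ)) =
        ∫ x, -‖L x + v‖ ^ 2 / 2 ∂μ := by
    rw [integral_div, integral_div, integral_neg, integral_neg,
      integral_norm_sq_affine_congr memLp_id_multivariateGaussian hμ
        integral_id_multivariateGaussian
        (covarianceMatrix_multivariateGaussian hS.posSemidef) L v]
  rw [hν]
  refine klDiv_tilted_le hac hμ' ?_ (hint _ _ hμ) (hint _ _ memLp_id_multivariateGaussian)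
    (hint _ _ hμ) (hint _ _ memLp_id_multivariateGaussian) (heq _ _) (heq _ _)
  by_contra h
  exact NeZero.ne (multivariateGaussian mα Sα) (by rw [hν, tilted_of_not_integrable h])

end Gaussian

/-! ### The affine map and its plan -/

section OptimalMap

variable {d : ℕ} {S₁ S₂ : Matrix (Fin d) (Fin d) ℝ} {m₁ m₂ : Space d}

lemma sqrt_mul_inv_cancel (h₁ : S₁.PosDef) : CFC.sqrt S₁ * (CFC.sqrt S₁)⁻¹ = 1 :=
  Matrix.mul_nonsing_inv _ ((Matrix.isUnit_iff_isUnit_det _).1 (posDef_sqrt h₁).isUnit)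

lemma sqrt_inv_mul_cancel (h₁ : S₁.PosDef) : (CFC.sqrt S₁)⁻¹ * CFC.sqrt S₁ = 1 :=
  Matrix.nonsing_inv_mul _ ((Matrix.isUnit_iff_isUnit_det _).1 (posDef_sqrt h₁).isUnit)

lemma posDef_conj {A B : Matrix (Fin d) (Fin d) ℝ} (hA : A.PosDef) (hB : B.PosDef) :
    (A * B * A).PosDef := by
  have h := (Matrix.IsUnit.posDef_star_left_conjugate_iff (x := B) hA.isUnit).2 hB
  rwa [Matrix.star_eq_conjTranspose, hA.isHermitian.eq] at h

lemma posDef_optimalMatrix (h₁ : S₁.PosDef) (h₂ : S₂.PosDef) : (optimalMatrix S₁ S₂).PosDef :=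
  posDef_conj (posDef_sqrt h₁).inv (posDef_sqrt (posDef_conj (posDef_sqrt h₁) h₂))

/-- The optimal matrix solves the Riccati equation `T S₁ T = S₂`. -/
lemma optimalMatrix_mul_mul (h₁ : S₁.PosDef) (h₂ : S₂.PosDef) :
    optimalMatrix S₁ S₂ * S₁ * optimalMatrix S₁ S₂ = S₂ := by
  have hB := CFC.sqrt_mul_sqrt_self _ (posDef_conj (posDef_sqrt h₁) h₂).posSemidef.nonneg
  have hA := CFC.sqrt_mul_sqrt_self _ h₁.posSemidef.nonneg
  have hAi := sqrt_mul_inv_cancel h₁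
  have hiA := sqrt_inv_mul_cancel h₁
  unfold optimalMatrix
  set A := CFC.sqrt S₁
  set B := CFC.sqrt (A * S₂ * A)
  calc A⁻¹ * B * A⁻¹ * S₁ * (A⁻¹ * B * A⁻¹)
      = A⁻¹ * B * (A⁻¹ * A) * (A * A⁻¹) * B * A⁻¹ := by rw [← hA]; simp only [mul_assoc]
    _ = A⁻¹ * (B * B) * A⁻¹ := by rw [hAi, hiA]; simp only [mul_assoc, mul_one]
    _ = (A⁻¹ * A) * S₂ * (A * A⁻¹) := by rw [hB]; simp only [mul_assoc]
    _ = S₂ := by rw [hAi, hiA, mul_one, one_mul]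

lemma adjoint_toEuclideanCLM {A : Matrix (Fin d) (Fin d) ℝ} (hA : A.IsHermitian) :
    (Matrix.toEuclideanCLM (𝕜 := ℝ) A).adjoint = Matrix.toEuclideanCLM (𝕜 := ℝ) A := by
  rw [← ContinuousLinearMap.star_eq_adjoint, ← map_star, Matrix.star_eq_conjTranspose, hA.eq]

lemma optimalMap_eq (m₁ m₂ : Space d) (S₁ S₂ : Matrix (Fin d) (Fin d) ℝ) :
    optimalMap m₁ S₁ m₂ S₂ = (fun x ↦ (m₂ - Matrix.toEuclideanCLM (𝕜 := ℝ) (optimalMatrix S₁ S₂) m₁)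
      + x) ∘ Matrix.toEuclideanCLM (𝕜 := ℝ) (optimalMatrix S₁ S₂) := by
  ext1 x
  exact add_comm _ _

lemma continuous_optimalMap : Continuous (optimalMap m₁ S₁ m₂ S₂) := by
  rw [optimalMap_eq]
  fun_prop

/-- Both sides are Gaussian, so it suffices to compare means, by the choice of `t`, and covariances,
by `T S₁ T = S₂`. -/
lemma map_optimalMap (h₁ : S₁.PosDef) (h₂ : S₂.PosDef) :
    (multivariateGaussian m₁ S₁).map (optimalMap m₁ S₁ m₂ S₂) = multivariateGaussian m₂ S₂ := by
  have hT := (posDef_optimalMatrix h₁ h₂).isHermitian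
  have hTST := optimalMatrix_mul_mul h₁ h₂
  rw [optimalMap_eq, ← Measure.map_map (measurable_const_add _) (by fun_prop)]
  have hTint : Integrable (fun x ↦ x) ((multivariateGaussian m₁ S₁).map
      (Matrix.toEuclideanCLM (𝕜 := ℝ) (optimalMatrix S₁ S₂))) := IsGaussian.integrable_id
  apply IsGaussian.ext
  · simp only [id_eq, integral_id_multivariateGaussian]
    rw [integral_map (by fun_prop) (by fun_prop), integral_add (integrable_const _) hTint,
      integral_const, probReal_univ, one_smul,
      ContinuousLinearMap.integral_id_map IsGaussian.integrable_id,
      integral_id_multivariateGaussian, sub_add_cancel]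
  · ext x y
    rw [covarianceBilin_map_const_add, covarianceBilin_map IsGaussian.memLp_two_id,
      adjoint_toEuclideanCLM hT, covarianceBilin_multivariateGaussian h₁.posSemidef,
      covarianceBilin_multivariateGaussian h₂.posSemidef,
      ← Matrix.inner_toEuclideanCLM, ← Matrix.inner_toEuclideanCLM,
      ← ContinuousLinearMap.adjoint_inner_right, adjoint_toEuclideanCLM hT, ← mul_apply_eq_comp,
      ← mul_apply_eq_comp, ← map_mul, ← map_mul, hTST]

lemma gaussianPlan_eq (c : ℝ≥0) :
    gaussianPlan c m₁ S₁ m₂ S₂ =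
      c • (multivariateGaussian m₁ S₁).map fun x ↦ (x, optimalMap m₁ S₁ m₂ S₂ x) := by
  rw [gaussianPlan, gaussianMeasure, Measure.map_smul]

lemma measurable_prodMk_optimalMap : Measurable fun x ↦ (x, optimalMap m₁ S₁ m₂ S₂ x) :=
  measurable_id.prodMk continuous_optimalMap.measurable

lemma isGaussian_map_prodMk_optimalMap :
    IsGaussian ((multivariateGaussian m₁ S₁).map fun x ↦ (x, optimalMap m₁ S₁ m₂ S₂ x)) := by
  let T := Matrix.toEuclideanCLM (𝕜 := ℝ) (optimalMatrix S₁ S₂)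
  have : (fun x ↦ (x, optimalMap m₁ S₁ m₂ S₂ x)) =
      (fun p : Space d × Space d ↦ (0, m₂ - T m₁) + p) ∘ ((ContinuousLinearMap.id ℝ _).prod T) := by
    ext1 x
    simp [optimalMap, T, add_comm]
  rw [this, ← Measure.map_map (measurable_const_add _) (by fun_prop)]
  infer_instance

instance (c : ℝ≥0) : IsFiniteMeasure (gaussianMeasure c m₁ S₁) := by
  unfold gaussianMeasure; infer_instance

instance (c : ℝ≥0) : IsFiniteMeasure (gaussianPlan c m₁ S₁ m₂ S₂) := by
  unfold gaussianPlan; infer_instance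

lemma fst_gaussianPlan (c : ℝ≥0) : (gaussianPlan c m₁ S₁ m₂ S₂).fst = gaussianMeasure c m₁ S₁ := by
  rw [gaussianPlan, Measure.fst, Measure.map_map measurable_fst measurable_prodMk_optimalMap]
  exact Measure.map_id

lemma snd_gaussianPlan (c : ℝ≥0) (h₁ : S₁.PosDef) (h₂ : S₂.PosDef) :
    (gaussianPlan c m₁ S₁ m₂ S₂).snd = gaussianMeasure c m₂ S₂ := by
  rw [gaussianPlan, Measure.snd, Measure.map_map measurable_snd measurable_prodMk_optimalMap,
    gaussianMeasure, Measure.map_smul]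
  change c • (multivariateGaussian m₁ S₁).map (optimalMap m₁ S₁ m₂ S₂) = _
  rw [map_optimalMap h₁ h₂, gaussianMeasure]

end OptimalMap

/-! ### Feasibility and finiteness of the cost -/

section Marginals

variable {d : ℕ} {c : ℝ≥0} {μ ν : Measure (Space d)} {π : Measure (Space d × Space d)}

lemma memLp_fst (hμ : MemLp id 2 μ) (h : π.fst = c • μ) : MemLp Prod.fst 2 π := by
  have h1 : MemLp id 2 π.fst := h ▸ hμ.smul_measure ENNReal.coe_ne_top
  exact (memLp_map_measure_iff (g := id) (f := Prod.fst) (by fun_prop) (by fun_prop)).1 h1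

lemma memLp_snd (hν : MemLp id 2 ν) (h : π.snd = c • ν) : MemLp Prod.snd 2 π := by
  have h1 : MemLp id 2 π.snd := h ▸ hν.smul_measure ENNReal.coe_ne_top
  exact (memLp_map_measure_iff (g := id) (f := Prod.snd) (by fun_prop) (by fun_prop)).1 h1

lemma isFeasible_of_marginals [IsFiniteMeasure π] (hμ : MemLp id 2 μ) (hν : MemLp id 2 ν)
    (h₁ : π.fst = c • μ) (h₂ : π.snd = c • ν) (hμac : μ ≪ volume) (hνac : ν ≪ volume) :
    IsFeasible (c • μ) (c • ν) π where
  finite := inferInstance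
  second_moment := by
    have := ((memLp_fst hμ h₁).integrable_norm_pow (by norm_num)).add
      ((memLp_snd hν h₂).integrable_norm_pow (by norm_num))
    exact Integrable.lintegral_lt_top this
  fst_eq := h₁
  snd_eq := h₂
  fst_ac := hμac.smul_left _
  snd_ac := hνac.smul_left _

lemma IsFeasible.memLp_fst {π₁ π₂ : Measure (Space d)} (h : IsFeasible π₁ π₂ π) :
    MemLp id 2 π₁ := by
  rw [← h.fst_eq, Measure.fst, memLp_map_measure_iff (by fun_prop) (by fun_prop)]
  refine (memLp_two_iff_integrable_sq_norm (by fun_prop)).2 ⟨by fun_prop, ?_⟩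
  rw [hasFiniteIntegral_iff_ofReal (ae_of_all _ fun p ↦ by positivity)]
  refine (lintegral_mono fun p ↦ ENNReal.ofReal_le_ofReal ?_).trans_lt h.second_moment
  simp

lemma IsFeasible.memLp_snd {π₁ π₂ : Measure (Space d)} (h : IsFeasible π₁ π₂ π) :
    MemLp id 2 π₂ := by
  rw [← h.snd_eq, Measure.snd, memLp_map_measure_iff (by fun_prop) (by fun_prop)]
  refine (memLp_two_iff_integrable_sq_norm (by fun_prop)).2 ⟨by fun_prop, ?_⟩
  rw [hasFiniteIntegral_iff_ofReal (ae_of_all _ fun p ↦ by positivity)]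
  refine (lintegral_mono fun p ↦ ENNReal.ofReal_le_ofReal ?_).trans_lt h.second_moment
  simp

lemma isProbabilityMeasure_inv_smul {X : Type*} [MeasurableSpace X] {ρ : Measure X} (hc : c ≠ 0)
    (h : ρ Set.univ = c) : IsProbabilityMeasure (c⁻¹ • ρ) :=
  ⟨by
    rw [Measure.smul_apply, h, ENNReal.smul_def, smul_eq_mul, ← ENNReal.coe_mul,
      inv_mul_cancel₀ hc, ENNReal.coe_one]⟩

lemma isFeasible_gaussianPlan (c : ℝ≥0) (m₁ m₂ : Space d) {S₁ S₂ : Matrix (Fin d) (Fin d) ℝ}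
    (h₁ : S₁.PosDef) (h₂ : S₂.PosDef) :
    IsFeasible (gaussianMeasure c m₁ S₁) (gaussianMeasure c m₂ S₂)
      (gaussianPlan c m₁ S₁ m₂ S₂) :=
  isFeasible_of_marginals memLp_id_multivariateGaussian memLp_id_multivariateGaussian
    (fst_gaussianPlan c) (snd_gaussianPlan c h₁ h₂)
    (multivariateGaussian_absolutelyContinuous h₁) (multivariateGaussian_absolutelyContinuous h₂)

lemma transportCost_eq_ofReal (hμ : MemLp id 2 μ) (hν : MemLp id 2 ν)
    (h₁ : π.fst = c • μ) (h₂ : π.snd = c • ν) :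
    transportCost π = ENNReal.ofReal (∫ p, ‖p.2 - p.1‖ ^ 2 ∂π) :=
  (ofReal_integral_eq_lintegral_ofReal
    (((memLp_snd hν h₂).sub (memLp_fst hμ h₁)).integrable_norm_pow (by norm_num))
    (ae_of_all _ fun p ↦ by positivity)).symm

end Marginals

/-! ### Optimality of the affine plan for the transport cost -/

section Cost

variable {d : ℕ} {c : ℝ≥0} {μ ν μ' ν' : Measure (Space d)} {π π' : Measure (Space d × Space d)}
  [IsProbabilityMeasure μ] [IsProbabilityMeasure ν] [IsProbabilityMeasure μ']
  [IsProbabilityMeasure ν'] [IsFiniteMeasure π] [IsFiniteMeasure π']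

/-- The quadratic cost, split into a function of `x`, a function of `y`, and a remainder that
vanishes on the graph of `x ↦ R (R x) + t`. -/
lemma norm_sub_sq_eq (R : Space d ≃L[ℝ] Space d) (hR : ∀ x y, inner ℝ (R x) y = inner ℝ x (R y))
    (t x y : Space d) :
    ‖y - x‖ ^ 2 = (2 * ‖ContinuousLinearMap.id ℝ _ x + 0‖ ^ 2 -
        ‖ContinuousLinearMap.id ℝ _ x + t‖ ^ 2 + ‖t‖ ^ 2 -
        ‖(R : Space d →L[ℝ] Space d) x + 0‖ ^ 2) +
      (‖ContinuousLinearMap.id ℝ _ y + 0‖ ^ 2 -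
        ‖(R.symm : Space d →L[ℝ] Space d) y + -R.symm t‖ ^ 2) +
      ‖R x - R.symm (y - t)‖ ^ 2 := by
  -- The only input beyond expanding squares: symmetry of `R` gives `⟨R x, R⁻¹ (y - t)⟩ = ⟨x, y -
  -- t⟩`.
  have h := hR x (R.symm (y - t))
  rw [R.apply_symm_apply, inner_sub_right] at h
  have e1 := norm_sub_sq_real y x
  have e2 := norm_add_sq_real x t
  have e3 := norm_sub_sq_real (R x) (R.symm (y - t))
  have e4 : R.symm y + -R.symm t = R.symm (y - t) := by rw [map_sub, sub_eq_add_neg]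
  rw [real_inner_comm] at e1
  simp only [ContinuousLinearMap.id_apply, add_zero, ContinuousLinearEquiv.coe_coe, e4]
  linarith

/-- Only the last term involves the coupling. The others are kept in the shape `‖L x + v‖²`, hence
the identity maps and the `+ 0`, so that `integral_norm_sq_affine_congr` applies to them. -/
lemma integral_cost_eq (R : Space d ≃L[ℝ] Space d)
    (hR : ∀ x y, inner ℝ (R x) y = inner ℝ x (R y)) (t : Space d)
    (hμ : MemLp id 2 μ) (hν : MemLp id 2 ν) (h₁ : π.fst = c • μ) (h₂ : π.snd = c • ν) :
    ∫ p, ‖p.2 - p.1‖ ^ 2 ∂π =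
      c * (2 * ∫ x, ‖ContinuousLinearMap.id ℝ _ x + 0‖ ^ 2 ∂μ -
        ∫ x, ‖ContinuousLinearMap.id ℝ _ x + t‖ ^ 2 ∂μ + ‖t‖ ^ 2 -
          ∫ x, ‖(R : Space d →L[ℝ] Space d) x + 0‖ ^ 2 ∂μ) +
      c * (∫ y, ‖ContinuousLinearMap.id ℝ _ y + 0‖ ^ 2 ∂ν -
        ∫ y, ‖(R.symm : Space d →L[ℝ] Space d) y + -R.symm t‖ ^ 2 ∂ν) +
      ∫ p, ‖R p.1 - R.symm (p.2 - t)‖ ^ 2 ∂π := by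
  have i1 := (integrable_norm_sq_affine hμ (ContinuousLinearMap.id ℝ _) 0).const_mul 2
  have i2 := integrable_norm_sq_affine hμ (ContinuousLinearMap.id ℝ _) t
  have i3 := integrable_norm_sq_affine hμ (R : Space d →L[ℝ] Space d) 0
  have i4 := integrable_norm_sq_affine hν (ContinuousLinearMap.id ℝ _) 0
  have i5 := integrable_norm_sq_affine hν (R.symm : Space d →L[ℝ] Space d) (-R.symm t)
  have ic : Integrable (fun _ : Space d ↦ ‖t‖ ^ 2) μ := integrable_const _
  have ix := ((i1.sub i2).add ic).sub i3
  have iy := i4.sub i5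
  have ix' : Integrable _ (π.map Prod.fst) := h₁.symm ▸ ix.smul_measure_nnreal (c := c)
  have iy' : Integrable _ (π.map Prod.snd) := h₂.symm ▸ iy.smul_measure_nnreal (c := c)
  have hx := (integrable_map_measure ix'.aestronglyMeasurable measurable_fst.aemeasurable).1 ix'
  have hy := (integrable_map_measure iy'.aestronglyMeasurable measurable_snd.aemeasurable).1 iy'
  have hz : Integrable (fun p : Space d × Space d ↦ ‖R p.1 - R.symm (p.2 - t)‖ ^ 2) π := by
    have m1 := (R : Space d →L[ℝ] Space d).comp_memLp' (memLp_fst hμ h₁)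
    have m2 := (R.symm : Space d →L[ℝ] Space d).comp_memLp'
      ((memLp_snd hν h₂).sub (memLp_const t))
    exact (m1.sub m2).integrable_norm_pow (by norm_num)
  simp_rw [fun p : Space d × Space d ↦ norm_sub_sq_eq R hR t p.1 p.2]
  have e0 := integral_add (hx.add hy) hz
  have e1 := integral_add hx hy
  have e2 := integral_map (μ := π) measurable_fst.aemeasurable
    ix'.aestronglyMeasurable
  have e3 := integral_map (μ := π) measurable_snd.aemeasurable
    iy'.aestronglyMeasurable
  have e4 := integral_sub ((i1.sub i2).add ic) i3
  have e5 := integral_add (i1.sub i2) ic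
  have e6 := integral_sub i1 i2
  have e7 := integral_sub i4 i5
  rw [← Measure.fst, h₁, integral_smul_nnreal_measure] at e2
  rw [← Measure.snd, h₂, integral_smul_nnreal_measure] at e3
  simp only [Pi.add_apply, Pi.sub_apply, Function.comp_apply, integral_const, probReal_univ,
    one_smul, integral_const_mul] at e0 e1 e2 e3 e4 e5 e6 e7
  rw [e0, e1, ← e2, ← e3, e4, e5, e6, e7]
  rfl

/-- A plan carried by the graph of the affine map `x ↦ R (R x) + t`, with `R` symmetric, costs
no more than any plan whose marginals have the same masses, means and covariances. -/
lemma transportCost_le_of_ae_eq (R : Space d ≃L[ℝ] Space d)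
    (hR : ∀ x y, inner ℝ (R x) y = inner ℝ x (R y)) (t : Space d)
    (hμ : MemLp id 2 μ) (hν : MemLp id 2 ν) (h₁ : π.fst = c • μ) (h₂ : π.snd = c • ν)
    (hμ' : MemLp id 2 μ') (hν' : MemLp id 2 ν') (h₁' : π'.fst = c • μ') (h₂' : π'.snd = c • ν')
    (hm₁ : ∫ x, x ∂μ = ∫ x, x ∂μ') (hS₁ : covarianceMatrix μ = covarianceMatrix μ')
    (hm₂ : ∫ x, x ∂ν = ∫ x, x ∂ν') (hS₂ : covarianceMatrix ν = covarianceMatrix ν')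
    (hgraph : ∀ᵐ p ∂π, p.2 = R (R p.1) + t) :
    transportCost π ≤ transportCost π' := by
  rw [transportCost_eq_ofReal hμ hν h₁ h₂, transportCost_eq_ofReal hμ' hν' h₁' h₂']
  apply ENNReal.ofReal_le_ofReal
  rw [integral_cost_eq R hR t hμ hν h₁ h₂, integral_cost_eq R hR t hμ' hν' h₁' h₂']
  simp_rw [integral_norm_sq_affine_congr hμ hμ' hm₁ hS₁,
    integral_norm_sq_affine_congr hν hν' hm₂ hS₂]
  have h0 : ∫ p, ‖R p.1 - R.symm (p.2 - t)‖ ^ 2 ∂π = 0 := by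
    rw [← integral_zero (Space d × Space d) ℝ (μ := π)]
    refine integral_congr_ae ?_
    filter_upwards [hgraph] with p hp
    simp [hp]
  rw [h0]
  gcongr
  exact integral_nonneg fun p ↦ by positivity

/-- The affine plan between Gaussian measures costs no more than any plan whose marginals have
the same masses, means and covariances. -/
lemma transportCost_gaussianPlan_le (hμ : MemLp id 2 μ) (hν : MemLp id 2 ν)
    (h₁ : π.fst = c • μ) (h₂ : π.snd = c • ν)
    (hS₁ : (covarianceMatrix μ).PosDef) (hS₂ : (covarianceMatrix ν).PosDef) :
    transportCost (gaussianPlan c (∫ x, x ∂μ) (covarianceMatrix μ) (∫ x, x ∂ν)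
      (covarianceMatrix ν)) ≤ transportCost π := by
  set m₁ := ∫ x, x ∂μ
  set m₂ := ∫ x, x ∂ν
  set S₁ := covarianceMatrix μ
  set S₂ := covarianceMatrix ν
  have hT := posDef_optimalMatrix hS₁ hS₂
  have hsq := posDef_sqrt hT
  set T := optimalMatrix S₁ S₂ with hTdef
  -- The choice `R = √T` makes `R (R x) + t` the affine map itself.
  refine transportCost_le_of_ae_eq (matrixEquiv (CFC.sqrt T) hsq.isUnit) (fun x y ↦ ?_)
    (m₂ - Matrix.toEuclideanCLM (𝕜 := ℝ) T m₁)
    (μ := multivariateGaussian m₁ S₁) (ν := multivariateGaussian m₂ S₂)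
    memLp_id_multivariateGaussian memLp_id_multivariateGaussian
    (fst_gaussianPlan c) (snd_gaussianPlan c hS₁ hS₂) hμ hν h₁ h₂
    integral_id_multivariateGaussian (covarianceMatrix_multivariateGaussian hS₁.posSemidef)
    integral_id_multivariateGaussian (covarianceMatrix_multivariateGaussian hS₂.posSemidef) ?_
  · rw [matrixEquiv_apply, matrixEquiv_apply, ← ContinuousLinearMap.adjoint_inner_right,
      adjoint_toEuclideanCLM hsq.isHermitian]
  · rw [gaussianPlan, ae_map_iff measurable_prodMk_optimalMap.aemeasurable]
    · refine ae_of_all _ fun x ↦ ?_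
      rw [matrixEquiv_apply, matrixEquiv_apply, ← mul_apply_eq_comp, ← map_mul,
        CFC.sqrt_mul_sqrt_self _ hT.posSemidef.nonneg]
      rfl
    · refine measurableSet_eq_fun measurable_snd ?_
      exact ((ContinuousLinearEquiv.continuous _).comp ((ContinuousLinearEquiv.continuous _).comp
        continuous_fst)).measurable.add_const _

end Cost

/-! ### Approximation by plans with a density -/

section RotatedPlan

variable {d : ℕ} {c : ℝ≥0} {m₁ m₂ : Space d} {S₁ S₂ : Matrix (Fin d) (Fin d) ℝ} {θ : ℝ}

/-- The linear part of `z ↦ (m₁ + √S₁ z₁, m₂ + T √S₁ (cos θ z₁ + sin θ z₂))`. -/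
noncomputable def rotatedLinear (S₁ S₂ : Matrix (Fin d) (Fin d) ℝ) (θ : ℝ) :
    Space d × Space d →L[ℝ] Space d × Space d :=
  ((Matrix.toEuclideanCLM (𝕜 := ℝ) (CFC.sqrt S₁)).comp (ContinuousLinearMap.fst ℝ _ _)).prod
    ((Matrix.toEuclideanCLM (𝕜 := ℝ) (optimalMatrix S₁ S₂ * CFC.sqrt S₁)).comp
      ((ContinuousLinearMap.fst ℝ _ _).comp (ContinuousLinearMap.rotation θ)))

/-- The coupling of `c · N(m₁, S₁)` and `c · N(m₂, S₂)` that rotates the affine plan by `θ`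
towards an independent copy. -/
noncomputable def rotatedPlan (c : ℝ≥0) (m₁ : Space d) (S₁ : Matrix (Fin d) (Fin d) ℝ)
    (m₂ : Space d) (S₂ : Matrix (Fin d) (Fin d) ℝ) (θ : ℝ) : Measure (Space d × Space d) :=
  c • ((stdGaussian (Space d)).prod (stdGaussian (Space d))).map
    fun z ↦ (m₁, m₂) + rotatedLinear S₁ S₂ θ z

instance : IsFiniteMeasure (rotatedPlan c m₁ S₁ m₂ S₂ θ) := by
  unfold rotatedPlan; infer_instance

lemma optimalMap_add (z : Space d) :
    optimalMap m₁ S₁ m₂ S₂ (m₁ + Matrix.toEuclideanCLM (𝕜 := ℝ) (CFC.sqrt S₁) z) =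
      m₂ + Matrix.toEuclideanCLM (𝕜 := ℝ) (optimalMatrix S₁ S₂ * CFC.sqrt S₁) z := by
  rw [optimalMap, map_add, map_mul, mul_apply_eq_comp]
  abel

lemma measurable_rotated : Measurable fun z ↦ (m₁, m₂) + rotatedLinear S₁ S₂ θ z :=
  (rotatedLinear S₁ S₂ θ).continuous.measurable.const_add _

lemma fst_rotatedPlan : (rotatedPlan c m₁ S₁ m₂ S₂ θ).fst = gaussianMeasure c m₁ S₁ := by
  rw [rotatedPlan, Measure.fst, Measure.map_smul, Measure.map_map measurable_fst measurable_rotated,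
    gaussianMeasure, multivariateGaussian]
  congr 1
  have : (Prod.fst ∘ fun z ↦ (m₁, m₂) + rotatedLinear S₁ S₂ θ z) =
      (fun x ↦ m₁ + Matrix.toEuclideanCLM (𝕜 := ℝ) (CFC.sqrt S₁) x) ∘ Prod.fst := rfl
  rw [this, ← Measure.map_map (by fun_prop) measurable_fst, ← Measure.fst, Measure.fst_prod]

/-- The product of two standard Gaussians is rotation invariant, so `cos θ z₁ + sin θ z₂` is again
standard Gaussian and the marginal does not depend on `θ`. -/
lemma snd_rotatedPlan (h₁ : S₁.PosDef) (h₂ : S₂.PosDef) :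
    (rotatedPlan c m₁ S₁ m₂ S₂ θ).snd = gaussianMeasure c m₂ S₂ := by
  rw [rotatedPlan, Measure.snd, Measure.map_smul, Measure.map_map measurable_snd measurable_rotated,
    gaussianMeasure, ← map_optimalMap (m₁ := m₁) h₁ h₂, multivariateGaussian,
    Measure.map_map continuous_optimalMap.measurable (by fun_prop)]
  congr 1
  have : (Prod.snd ∘ fun z ↦ (m₁, m₂) + rotatedLinear S₁ S₂ θ z) =
      ((optimalMap m₁ S₁ m₂ S₂ ∘ fun x ↦ m₁ + Matrix.toEuclideanCLM (𝕜 := ℝ) (CFC.sqrt S₁) x) ∘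
        Prod.fst) ∘ ContinuousLinearMap.rotation θ := by
    ext1 z
    exact (optimalMap_add _).symm
  have hmeas : Measurable
      (optimalMap m₁ S₁ m₂ S₂ ∘ fun x ↦ m₁ + Matrix.toEuclideanCLM (𝕜 := ℝ) (CFC.sqrt S₁) x) :=
    continuous_optimalMap.measurable.comp (by fun_prop)
  rw [this, ← Measure.map_map (hmeas.comp measurable_fst) (by fun_prop),
    IsGaussian.map_rotation_eq_self (by simp),
    ← Measure.map_map hmeas measurable_fst, ← Measure.fst, Measure.fst_prod]

lemma toEuclideanCLM_eq_zero {A : Matrix (Fin d) (Fin d) ℝ} (hA : IsUnit A) {x : Space d}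
    (hx : Matrix.toEuclideanCLM (𝕜 := ℝ) A x = 0) : x = 0 :=
  (matrixEquiv A hA).map_eq_zero_iff.1 hx

/-- The map is block triangular: the first component determines `z₁`, and then `sin θ ≠ 0` recovers
`z₂` from the second. -/
lemma det_rotatedLinear_ne_zero (h₁ : S₁.PosDef) (h₂ : S₂.PosDef) (hθ : Real.sin θ ≠ 0) :
    LinearMap.det (rotatedLinear S₁ S₂ θ : Space d × Space d →ₗ[ℝ] Space d × Space d) ≠ 0 := by
  refine IsUnit.ne_zero (LinearMap.isUnit_det _ ((LinearMap.isUnit_iff_ker_eq_bot _).2 ?_))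
  refine LinearMap.ker_eq_bot'.2 fun z hz ↦ ?_
  obtain ⟨x, y⟩ := z
  have hx : x = 0 := toEuclideanCLM_eq_zero (posDef_sqrt h₁).isUnit (congrArg Prod.fst hz)
  have hy : Real.cos θ • x + Real.sin θ • y = 0 := toEuclideanCLM_eq_zero
    ((posDef_optimalMatrix h₁ h₂).isUnit.mul (posDef_sqrt h₁).isUnit) (congrArg Prod.snd hz)
  rw [hx, smul_zero, zero_add, smul_eq_zero] at hy
  rw [hx, hy.resolve_left hθ]
  rfl

lemma rotatedPlan_absolutelyContinuous (h₁ : S₁.PosDef) (h₂ : S₂.PosDef) (hθ : Real.sin θ ≠ 0) :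
    rotatedPlan c m₁ S₁ m₂ S₂ θ ≪ volume := by
  refine Measure.AbsolutelyContinuous.smul_left (c := c) ?_
  have hprod : (stdGaussian (Space d)).prod (stdGaussian (Space d)) ≪ volume :=
    stdGaussian_absolutelyContinuous.prod stdGaussian_absolutelyContinuous
  refine (hprod.map measurable_rotated).trans ?_
  have hcomp : (fun z ↦ (m₁, m₂) + rotatedLinear S₁ S₂ θ z) = (fun z ↦ (m₁, m₂) + z) ∘
      (rotatedLinear S₁ S₂ θ : Space d × Space d →ₗ[ℝ] Space d × Space d) := rfl
  have : (volume : Measure (Space d × Space d)).IsAddHaarMeasure :=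
    Measure.prod.instIsAddHaarMeasure volume volume
  rw [hcomp, ← Measure.map_map (g := fun z ↦ (m₁, m₂) + z)
    (f := (rotatedLinear S₁ S₂ θ : Space d × Space d →ₗ[ℝ] Space d × Space d))
    (measurable_const_add _) (rotatedLinear S₁ S₂ θ).continuous.measurable,
    Measure.map_linearMap_addHaar_eq_smul_addHaar _ (det_rotatedLinear_ne_zero h₁ h₂ hθ),
    Measure.map_smul, map_add_left_eq_self]
  exact Measure.smul_absolutelyContinuous

lemma isFeasible_rotatedPlan (h₁ : S₁.PosDef) (h₂ : S₂.PosDef) :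
    IsFeasible (gaussianMeasure c m₁ S₁) (gaussianMeasure c m₂ S₂)
      (rotatedPlan c m₁ S₁ m₂ S₂ θ) :=
  isFeasible_of_marginals memLp_id_multivariateGaussian memLp_id_multivariateGaussian
    fst_rotatedPlan (snd_rotatedPlan h₁ h₂)
    (multivariateGaussian_absolutelyContinuous h₁) (multivariateGaussian_absolutelyContinuous h₂)

lemma rotatedPlan_zero : rotatedPlan c m₁ S₁ m₂ S₂ 0 = gaussianPlan c m₁ S₁ m₂ S₂ := by
  rw [gaussianPlan_eq, rotatedPlan, multivariateGaussian,
    Measure.map_map measurable_prodMk_optimalMap (by fun_prop)]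
  congr 1
  -- The single standard Gaussian is seen as a marginal of the product, so that both sides are
  -- images of the same measure.
  nth_rw 3 [← Measure.fst_prod (μ := stdGaussian (Space d)) (ν := stdGaussian (Space d))]
  rw [Measure.fst, Measure.map_map (measurable_prodMk_optimalMap.comp (by fun_prop)) measurable_fst]
  congr 1
  ext1 z
  refine Prod.ext rfl ?_
  simp only [Function.comp_apply, optimalMap_add]
  simp [rotatedLinear, ContinuousLinearMap.rotation]

lemma transportCost_rotatedPlan : transportCost (rotatedPlan c m₁ S₁ m₂ S₂ θ) =
    c * ∫⁻ z, ENNReal.ofReal (‖(m₂ + (rotatedLinear S₁ S₂ θ z).2) -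
      (m₁ + (rotatedLinear S₁ S₂ θ z).1)‖ ^ 2)
      ∂(stdGaussian (Space d)).prod (stdGaussian (Space d)) := by
  rw [transportCost, rotatedPlan, lintegral_smul_measure, lintegral_map (by fun_prop)
    measurable_rotated]
  rfl

lemma memLp_affine_norm_stdGaussian_prod (a b a' b' : ℝ) :
    MemLp (fun z : Space d × Space d ↦ a + b * (‖z.1‖ + ‖z.2‖) + (a' + b' * ‖z.1‖)) 2
      ((stdGaussian (Space d)).prod (stdGaussian (Space d))) := by
  have hG : MemLp id 2 (stdGaussian (Space d)) := IsGaussian.memLp_two_id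
  have i1 := (memLp_fst (c := 1) (π := (stdGaussian (Space d)).prod (stdGaussian (Space d))) hG
    (by rw [Measure.fst_prod, one_smul])).norm
  have i2 := (memLp_snd (c := 1) (π := (stdGaussian (Space d)).prod (stdGaussian (Space d))) hG
    (by rw [Measure.snd_prod, one_smul])).norm
  exact ((memLp_const a).add ((i1.add i2).const_mul b)).add
    ((memLp_const a').add (i1.const_mul b'))

lemma tendsto_transportCost_rotatedPlan :
    Filter.Tendsto (fun θ ↦ transportCost (rotatedPlan c m₁ S₁ m₂ S₂ θ)) (nhds 0)
      (nhds (transportCost (gaussianPlan c m₁ S₁ m₂ S₂))) := by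
  rw [← rotatedPlan_zero]
  simp_rw [transportCost_rotatedPlan]
  refine ENNReal.Tendsto.const_mul ?_ (Or.inr ENNReal.coe_ne_top)
  set A := Matrix.toEuclideanCLM (𝕜 := ℝ) (CFC.sqrt S₁) with hA
  set B := Matrix.toEuclideanCLM (𝕜 := ℝ) (optimalMatrix S₁ S₂ * CFC.sqrt S₁) with hB
  have h1 (θ : ℝ) (z : Space d × Space d) : (rotatedLinear S₁ S₂ θ z).1 = A z.1 := rfl
  have h2 (θ : ℝ) (z : Space d × Space d) : (rotatedLinear S₁ S₂ θ z).2 =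
      B (Real.cos θ • z.1 + Real.sin θ • z.2) := rfl
  simp_rw [h1, h2]
  -- Since `|cos θ|` and `|sin θ|` are at most `1`, the square of this function dominates the
  -- integrand for every `θ`.
  have hmem := memLp_affine_norm_stdGaussian_prod (d := d) ‖m₂‖ ‖B‖ ‖m₁‖ ‖A‖
  refine tendsto_lintegral_filter_of_dominated_convergence (fun z ↦ ENNReal.ofReal
    ((‖m₂‖ + ‖B‖ * (‖z.1‖ + ‖z.2‖) + (‖m₁‖ + ‖A‖ * ‖z.1‖)) ^ 2))
    (Filter.Eventually.of_forall fun θ ↦ by fun_prop)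
    (Filter.Eventually.of_forall fun θ ↦ ae_of_all _ fun z ↦ ?_)
    hmem.integrable_sq.lintegral_lt_top.ne (ae_of_all _ fun z ↦ ?_)
  · refine ENNReal.ofReal_le_ofReal (pow_le_pow_left₀ (norm_nonneg _) ?_ 2)
    refine (norm_sub_le _ _).trans (add_le_add ((norm_add_le _ _).trans ?_)
      ((norm_add_le _ _).trans ?_))
    · gcongr
      refine (B.le_opNorm _).trans ?_
      gcongr
      refine (norm_add_le _ _).trans ?_
      rw [norm_smul, norm_smul]
      gcongr
      · exact mul_le_of_le_one_left (norm_nonneg _) (Real.abs_cos_le_one _)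
      · exact mul_le_of_le_one_left (norm_nonneg _) (Real.abs_sin_le_one _)
    · gcongr
      exact A.le_opNorm _
  · have hc : Continuous fun θ : ℝ ↦ ENNReal.ofReal
        (‖m₂ + B (Real.cos θ • z.1 + Real.sin θ • z.2) - (m₁ + A z.1)‖ ^ 2) :=
      ENNReal.continuous_ofReal.comp (by fun_prop)
    exact hc.tendsto 0

end RotatedPlan

/-- The marginals of a feasible plan of mass `c > 0`, divided by `c`. -/
lemma IsFeasible.exists_normalized {d : ℕ} {π₁ π₂ : Measure (Space d)}
    {π : Measure (Space d × Space d)} {c : ℝ≥0} (h : IsFeasible π₁ π₂ π) (hc : c ≠ 0)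
    (hπ : π Set.univ = c) :
    ∃ μ ν : Measure (Space d), IsProbabilityMeasure μ ∧ IsProbabilityMeasure ν ∧
      MemLp id 2 μ ∧ MemLp id 2 ν ∧ π.fst = c • μ ∧ π.snd = c • ν ∧ μ ≪ volume ∧ ν ≪ volume ∧
      μ = c⁻¹ • π₁ ∧ ν = c⁻¹ • π₂ := by
  refine ⟨c⁻¹ • π₁, c⁻¹ • π₂, isProbabilityMeasure_inv_smul hc ?_,
    isProbabilityMeasure_inv_smul hc ?_, h.memLp_fst.smul_measure ENNReal.coe_ne_top,
    h.memLp_snd.smul_measure ENNReal.coe_ne_top, ?_, ?_, h.fst_ac.smul_left _,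
    h.snd_ac.smul_left _, rfl, rfl⟩
  · rw [← h.fst_eq, Measure.fst_univ, hπ]
  · rw [← h.snd_eq, Measure.snd_univ, hπ]
  · rw [h.fst_eq, smul_smul, mul_inv_cancel₀ hc, one_smul]
  · rw [h.snd_eq, smul_smul, mul_inv_cancel₀ hc, one_smul]

/-! ### Comparison of the three optimal values -/

section Values

variable {d : ℕ} {γ : ℝ≥0} {α β : Measure (Space d)}

lemma uotValue_le_uotValueAC : uotValue γ α β ≤ uotValueAC γ α β := by
  refine iInf_mono fun π₁ ↦ iInf_mono fun π₂ ↦ iInf_mono fun π ↦ iInf_mono fun h ↦ ?_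
  exact le_iInf fun _ ↦ le_rfl

lemma uotValueAC_le_gaussianValue : uotValueAC γ α β ≤ gaussianValue γ α β := by
  refine le_iInf fun c ↦ le_iInf fun m₁ ↦ le_iInf fun S₁ ↦ le_iInf fun m₂ ↦ le_iInf fun S₂ ↦
    le_iInf fun _ ↦ le_iInf fun h₁ ↦ le_iInf fun h₂ ↦ ?_
  -- The marginals are independent of `θ`, so only the transport term varies.
  have hlim : Filter.Tendsto (fun θ ↦ objective γ α β (rotatedPlan c m₁ S₁ m₂ S₂ θ))
      (nhdsWithin 0 (Set.Ioi 0)) (nhds (objective γ α β (gaussianPlan c m₁ S₁ m₂ S₂))) := by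
    simp_rw [objective, fst_rotatedPlan, snd_rotatedPlan h₁ h₂, fst_gaussianPlan,
      snd_gaussianPlan c h₁ h₂]
    exact ((tendsto_transportCost_rotatedPlan.mono_left nhdsWithin_le_nhds).add_const _).add_const _
  refine ge_of_tendsto hlim ?_
  filter_upwards [Ioo_mem_nhdsGT Real.pi_pos] with θ hθ
  have hsin : Real.sin θ ≠ 0 := (Real.sin_pos_of_mem_Ioo hθ).ne'
  exact iInf_le_of_le _ <| iInf_le_of_le _ <| iInf_le_of_le _ <|
    iInf_le_of_le (isFeasible_rotatedPlan h₁ h₂) <|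
    iInf_le_of_le (rotatedPlan_absolutelyContinuous h₁ h₂ hsin) le_rfl

/-- The divergence equals `c log (c / a) - c + a`, and the logarithm is nonpositive for `c ≤ a`. -/
lemma klDiv_smul_smul_self_le {X : Type*} [MeasurableSpace X] {μ : Measure X}
    [IsProbabilityMeasure μ] {c a : ℝ≥0} (hc : 0 < c) (hca : c ≤ a) :
    klDiv (c • μ) (a • μ) ≤ a := by
  have hac : a = c * (c⁻¹ * a) := (mul_inv_cancel_left₀ hc.ne' a).symm
  have hk : 1 ≤ c⁻¹ * a := by
    rw [← inv_mul_cancel₀ hc.ne']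
    gcongr
  generalize c⁻¹ * a = k at hac hk
  subst hac
  have hk0 : k ≠ 0 := (zero_lt_one.trans_le hk).ne'
  have hi : Integrable (llr μ μ) μ := (integrable_congr (llr_self μ)).2 (integrable_zero _ _ _)
  have hac : μ ≪ k • μ := Measure.AbsolutelyContinuous.rfl.smul_right
    (c := (k : ℝ≥0∞)) (by simpa)
  have htop : klDiv μ (k • μ) ≠ ∞ := by
    refine klDiv_ne_top hac ?_
    rw [integrable_congr (llr_smul_nnreal_right Measure.AbsolutelyContinuous.rfl k (by simpa))]
    exact hi.sub (integrable_const _)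
  rw [mul_smul, klDiv_smul_same, ENNReal.coe_mul]
  gcongr
  rw [← ENNReal.toReal_le_toReal htop ENNReal.coe_ne_top,
    toReal_klDiv_smul_right Measure.AbsolutelyContinuous.rfl hi hk0, klDiv_self]
  simp only [ENNReal.toReal_zero, probReal_univ, ENNReal.coe_toReal]
  have : 0 ≤ Real.log k := Real.log_nonneg (by exact_mod_cast hk)
  linarith

lemma transportCost_gaussianPlan_eq_mul {m₁ m₂ : Space d} {S₁ S₂ : Matrix (Fin d) (Fin d) ℝ}
    (c : ℝ≥0) : transportCost (gaussianPlan c m₁ S₁ m₂ S₂) =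
      c * transportCost (gaussianPlan 1 m₁ S₁ m₂ S₂) := by
  rw [gaussianPlan_eq, gaussianPlan_eq, one_smul, transportCost, lintegral_smul_measure]
  rfl

/-- The zero plan is feasible but excluded by `0 < c`. Its value `γ cα + γ cβ` bounds the limit as
`c → 0` of the objective at the affine plans between the normalised `α` and `β`, scaled to mass `c`,
whose transport cost is linear in `c`. -/
lemma gaussianValue_le_objective_zero {cα cβ : ℝ≥0} (hcα : 0 < cα) (hcβ : 0 < cβ)
    (mα mβ : Space d) {Sα Sβ : Matrix (Fin d) (Fin d) ℝ} (hSα : Sα.PosDef) (hSβ : Sβ.PosDef) :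
    gaussianValue γ (gaussianMeasure cα mα Sα) (gaussianMeasure cβ mβ Sβ) ≤
      objective γ (gaussianMeasure cα mα Sα) (gaussianMeasure cβ mβ Sβ) 0 := by
  set W := transportCost (gaussianPlan 1 mα Sα mβ Sβ) with hW
  have hWtop : W ≠ ∞ := by
    rw [hW, transportCost_eq_ofReal memLp_id_multivariateGaussian memLp_id_multivariateGaussian
      (fst_gaussianPlan 1) (snd_gaussianPlan 1 hSα hSβ)]
    exact ENNReal.ofReal_ne_top
  have hzero : objective γ (gaussianMeasure cα mα Sα) (gaussianMeasure cβ mβ Sβ) 0 =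
      0 + γ * cα + γ * cβ := by
    simp [objective, transportCost, gaussianMeasure, Measure.fst, Measure.snd]
  have hlim : Filter.Tendsto (fun c : ℝ≥0 ↦ (c : ℝ≥0∞) * W + γ * cα + γ * cβ)
      (nhdsWithin 0 (Set.Ioi 0)) (nhds (0 + γ * cα + γ * cβ)) := by
    refine ((Filter.Tendsto.mono_left ?_ nhdsWithin_le_nhds).add_const _).add_const _
    have h0 : Filter.Tendsto (fun c : ℝ≥0 ↦ (c : ℝ≥0∞)) (nhds 0) (nhds ((0 : ℝ≥0) : ℝ≥0∞)) :=
      ENNReal.tendsto_coe.2 Filter.tendsto_id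
    simpa using ENNReal.Tendsto.mul_const h0 (Or.inr hWtop)
  rw [hzero]
  refine ge_of_tendsto hlim ?_
  filter_upwards [Ioo_mem_nhdsGT (lt_min hcα hcβ)] with c hc
  refine iInf_le_of_le c <| iInf_le_of_le mα <| iInf_le_of_le Sα <| iInf_le_of_le mβ <|
    iInf_le_of_le Sβ <| iInf_le_of_le hc.1 <| iInf_le_of_le hSα <| iInf_le_of_le hSβ ?_
  rw [objective, fst_gaussianPlan, snd_gaussianPlan c hSα hSβ, transportCost_gaussianPlan_eq_mul]
  gcongr
  · exact klDiv_smul_smul_self_le hc.1 (hc.2.le.trans (min_le_left _ _))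
  · exact klDiv_smul_smul_self_le hc.1 (hc.2.le.trans (min_le_right _ _))

lemma objective_gaussianPlan_le {c cα cβ : ℝ≥0} (hc : c ≠ 0) (hcα : cα ≠ 0) (hcβ : cβ ≠ 0)
    {mα mβ : Space d} {Sα Sβ : Matrix (Fin d) (Fin d) ℝ} (hSα : Sα.PosDef) (hSβ : Sβ.PosDef)
    {μ ν : Measure (Space d)} [IsProbabilityMeasure μ] [IsProbabilityMeasure ν]
    {π : Measure (Space d × Space d)} [IsFiniteMeasure π] (hμ : MemLp id 2 μ) (hν : MemLp id 2 ν)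
    (h₁ : π.fst = c • μ) (h₂ : π.snd = c • ν) (hμac : μ ≪ volume) (hνac : ν ≪ volume) :
    objective γ (gaussianMeasure cα mα Sα) (gaussianMeasure cβ mβ Sβ)
      (gaussianPlan c (∫ x, x ∂μ) (covarianceMatrix μ) (∫ x, x ∂ν) (covarianceMatrix ν)) ≤
    objective γ (gaussianMeasure cα mα Sα) (gaussianMeasure cβ mβ Sβ) π := by
  have hS₁ := posDef_covarianceMatrix hμ hμac
  have hS₂ := posDef_covarianceMatrix hν hνac
  rw [objective, objective, fst_gaussianPlan, snd_gaussianPlan c hS₁ hS₂, h₁, h₂]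
  gcongr
  · exact transportCost_gaussianPlan_le hμ hν h₁ h₂ hS₁ hS₂
  · exact klDiv_smul_smul_mono hc hcα (klDiv_multivariateGaussian_le hμ hμac hSα)
  · exact klDiv_smul_smul_mono hc hcβ (klDiv_multivariateGaussian_le hν hνac hSβ)

lemma gaussianValue_le_uotValue {cα cβ : ℝ≥0} (hcα : 0 < cα) (hcβ : 0 < cβ)
    (mα mβ : Space d) {Sα Sβ : Matrix (Fin d) (Fin d) ℝ} (hSα : Sα.PosDef) (hSβ : Sβ.PosDef) :
    gaussianValue γ (gaussianMeasure cα mα Sα) (gaussianMeasure cβ mβ Sβ) ≤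
      uotValue γ (gaussianMeasure cα mα Sα) (gaussianMeasure cβ mβ Sβ) := by
  refine le_iInf fun π₁ ↦ le_iInf fun π₂ ↦ le_iInf fun π ↦ le_iInf fun h ↦ ?_
  have := h.finite
  obtain ⟨c, hc⟩ : ∃ c : ℝ≥0, π Set.univ = c :=
    ⟨_, (ENNReal.coe_toNNReal (measure_ne_top π _)).symm⟩
  rcases eq_zero_or_pos c with rfl | hcpos
  · rw [Measure.measure_univ_eq_zero.1 hc]
    exact gaussianValue_le_objective_zero hcα hcβ mα mβ hSα hSβ
  · obtain ⟨μ, ν, _, _, hμ, hν, h₁, h₂, hμac, hνac, -, -⟩ := h.exists_normalized hcpos.ne' hc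
    exact iInf_le_of_le c <| iInf_le_of_le (∫ x, x ∂μ) <| iInf_le_of_le (covarianceMatrix μ) <|
      iInf_le_of_le (∫ x, x ∂ν) <| iInf_le_of_le (covarianceMatrix ν) <| iInf_le_of_le hcpos <|
      iInf_le_of_le (posDef_covarianceMatrix hμ hμac) <|
      iInf_le_of_le (posDef_covarianceMatrix hν hνac) <|
      objective_gaussianPlan_le hcpos.ne' hcα.ne' hcβ.ne' hSα hSβ hμ hν h₁ h₂ hμac hνac

end Values
end UOT

/-! ### Optimality of Gaussian plans -/

theorem mainTheorem1 (d : ℕ) (hd : 0 < d) (γ : ℝ≥0) (hγ : 0 < γ)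
    (cα cβ : ℝ≥0) (hcα : 0 < cα) (hcβ : 0 < cβ) (mα mβ : UOT.Space d)
    (Sα Sβ : Matrix (Fin d) (Fin d) ℝ) (hSα : Sα.PosDef) (hSβ : Sβ.PosDef)
    (α β : Measure (UOT.Space d))
    (hα : α = UOT.gaussianMeasure cα mα Sα) (hβ : β = UOT.gaussianMeasure cβ mβ Sβ) :
    (∀ (π₁ π₂ : Measure (UOT.Space d)) (π : Measure (UOT.Space d × UOT.Space d)) (c : ℝ≥0)
      (m₁ m₂ : UOT.Space d) (S₁ S₂ : Matrix (Fin d) (Fin d) ℝ),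
      UOT.IsFeasible π₁ π₂ π → 0 < c → π Set.univ = c →
      m₁ = ∫ x, x ∂(c⁻¹ • π₁) → S₁ = UOT.covarianceMatrix (c⁻¹ • π₁) →
      m₂ = ∫ x, x ∂(c⁻¹ • π₂) → S₂ = UOT.covarianceMatrix (c⁻¹ • π₂) →
      S₁.PosDef ∧ S₂.PosDef ∧
      UOT.IsFeasible (UOT.gaussianMeasure c m₁ S₁) (UOT.gaussianMeasure c m₂ S₂)
        (UOT.gaussianPlan c m₁ S₁ m₂ S₂) ∧
      (∃ ν : Measure (UOT.Space d × UOT.Space d),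
        IsGaussian ν ∧ UOT.gaussianPlan c m₁ S₁ m₂ S₂ = c • ν) ∧
      (∀ π' : Measure (UOT.Space d × UOT.Space d),
        π'.fst = UOT.gaussianMeasure c m₁ S₁ → π'.snd = UOT.gaussianMeasure c m₂ S₂ →
        UOT.transportCost (UOT.gaussianPlan c m₁ S₁ m₂ S₂) ≤ UOT.transportCost π') ∧
      UOT.objective γ α β (UOT.gaussianPlan c m₁ S₁ m₂ S₂) ≤ UOT.objective γ α β π) ∧
    UOT.uotValue γ α β = UOT.gaussianValue γ α β ∧
    UOT.uotValueAC γ α β = UOT.gaussianValue γ α β := by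
  subst hα hβ
  refine ⟨fun π₁ π₂ π c m₁ m₂ S₁ S₂ h hc hπ hm₁ hS₁ hm₂ hS₂ ↦ ?_, ?_, ?_⟩
  · have := h.finite
    obtain ⟨μ, ν, _, _, hμ, hν, h₁, h₂, hμac, hνac, hμeq, hνeq⟩ := h.exists_normalized hc.ne' hπ
    rw [← hμeq] at hm₁ hS₁
    rw [← hνeq] at hm₂ hS₂
    have hpos₁ : S₁.PosDef := hS₁ ▸ UOT.posDef_covarianceMatrix hμ hμac
    have hpos₂ : S₂.PosDef := hS₂ ▸ UOT.posDef_covarianceMatrix hν hνac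
    refine ⟨hpos₁, hpos₂, UOT.isFeasible_gaussianPlan c m₁ m₂ hpos₁ hpos₂,
      ⟨_, UOT.isGaussian_map_prodMk_optimalMap, UOT.gaussianPlan_eq c⟩, fun π' h₁' h₂' ↦ ?_, ?_⟩
    · have : IsFiniteMeasure π' := ⟨by
        rw [← Measure.fst_univ, h₁']
        exact measure_lt_top _ _⟩
      have hcov₁ := UOT.covarianceMatrix_multivariateGaussian (m := m₁) hpos₁.posSemidef
      have hcov₂ := UOT.covarianceMatrix_multivariateGaussian (m := m₂) hpos₂.posSemidef
      -- The bound for general marginals is applied to the Gaussian marginals themselves, whose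
      -- moments are `m₁, S₁` and `m₂, S₂`.
      have key := UOT.transportCost_gaussianPlan_le UOT.memLp_id_multivariateGaussian
        UOT.memLp_id_multivariateGaussian h₁' h₂' (hcov₁.symm ▸ hpos₁) (hcov₂.symm ▸ hpos₂)
      rwa [integral_id_multivariateGaussian, integral_id_multivariateGaussian, hcov₁, hcov₂] at key
    · rw [hm₁, hS₁, hm₂, hS₂]
      exact UOT.objective_gaussianPlan_le hc.ne' hcα.ne' hcβ.ne' hSα hSβ hμ hν h₁ h₂ hμac hνac
  · exact le_antisymm (UOT.uotValue_le_uotValueAC.trans UOT.uotValueAC_le_gaussianValue)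
      (UOT.gaussianValue_le_uotValue hcα hcβ mα mβ hSα hSβ)
  · exact le_antisymm UOT.uotValueAC_le_gaussianValue
      ((UOT.gaussianValue_le_uotValue hcα hcβ mα mβ hSα hSβ).trans UOT.uotValue_le_uotValueAC)
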